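/- For $\alpha>-1$ let $L_n^\alpha(x)=\sum_{j=0}^n\binom{n+\alpha}{n-j}\frac{(-x)^j}{j!}$, $n\ge 0$, be the Laguerre polynomials, and let $(u)_s=u(u+1)\cdots(u+s-1)$ denote the Pochhammer symbol, with $(u)_0=1$. A linear operator $T$ on the space of real polynomials such that $\deg T(p)=\deg p$ for every $p$ is said to preserve real-rootedness up to degree $K$ if, for every polynomial $p$ of degree at most $K$ all of whose complex zeros are real, all the complex zeros of $T(p)$ are real; $T$ is said to preserve real-rootedness if it preserves real-rootedness up to degree $K$ for every positive integer $K$. (The zero polynomial is not counted among the polynomials having only real zeros.) Let $T$ be the linear operator on real polynomials defined by $T(x^n)=p_n$, $n\ge 0$. In each of the following cases $T$ satisfies $\deg T(p)=\deg p$ for every $p$, and: 1. If $p_n=L_n^\alpha$, where $\alpha>-1$ is not a non-negative integer, then for every positive integer $K$, $T$ preserves real-rootedness up to degree $K$ if and only if $\alpha>K-2$. 2. If $p_n=L_n^\alpha$, where $\alpha$ is a non-negative integer, then $T$ preserves real-rootedness. 3. If $p_n=\frac{n!}{(1+\alpha)_n}L_n^\alpha$, where $\alpha>-1$, then $T$ preserves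 real-rootedness. 4. If $p_n=\frac{1}{(1+\alpha)_n}L_n^\alpha$, where $\alpha>-1$, then $T$ preserves real-rootedness. -/

import Mathlib

open Polynomial

noncomputable section

/-- The Pochhammer symbol `(u)_s = u (u + 1) ⋯ (u + s - 1)`. -/
def poch (u : ℝ) (s : ℕ) : ℝ := (ascPochhammer ℝ s).eval u

/-- The Laguerre polynomial
`L_n^α(x) = ∑_{j=0}^n (-x)^j / j! * binom(n + α, n - j)`, where the generalized binomial coefficient
is `binom(n + α, n - j) = (α + j + 1)_{n - j} / (n - j)!`. -/
def laguerreL (α : ℝ) (n : ℕ) : ℝ[X] :=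
  ∑ j ∈ Finset.range (n + 1),
    C ((-1) ^ j * poch (α + j + 1) (n - j) / ((j.factorial : ℝ) * ((n - j).factorial : ℝ))) * X ^ j

/-- The normalization `n! L_n^α / (1 + α)_n`, which takes the value `1` at `0`. -/
def laguerreUnit (α : ℝ) (n : ℕ) : ℝ[X] :=
  C ((n.factorial : ℝ) / poch (1 + α) n) * laguerreL α n

/-- The Brenke normalization `L_n^α / (1 + α)_n`. -/
def laguerreBrenke (α : ℝ) (n : ℕ) : ℝ[X] :=
  C (1 / poch (1 + α) n) * laguerreL α n

/-- The linear operator `T` on real polynomials determined by `T(x^n) = p_n`. -/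
def monomialOp (p : ℕ → ℝ[X]) : ℝ[X] →ₗ[ℝ] ℝ[X] :=
  (basisMonomials ℝ).constr ℝ p

theorem monomialOp_X_pow (p : ℕ → ℝ[X]) (n : ℕ) : monomialOp p (X ^ n) = p n := by
  have h := (basisMonomials ℝ).constr_basis ℝ p n
  rw [coe_basisMonomials] at h
  simpa [monomialOp, X_pow_eq_monomial] using h

/-- All the complex zeros of the real polynomial `p` are real. (Nonzero constants qualify,
the zero polynomial does not.) -/
def OnlyRealZeros (p : ℝ[X]) : Prop :=
  ∀ z : ℂ, aeval z p = 0 → z.im = 0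

/-- A linear operator `T` on real polynomials with `deg T(p) = deg p` preserves real-rootedness
up to degree `K` if `T(p)` has only real zeros whenever `p` has only real zeros and has degree at
most `K`. -/
def PreservesRealRootednessUpTo (K : ℕ) (T : ℝ[X] →ₗ[ℝ] ℝ[X]) : Prop :=
  (∀ p : ℝ[X], (T p).degree = p.degree) ∧
    ∀ p : ℝ[X], OnlyRealZeros p → p.natDegree ≤ K → OnlyRealZeros (T p)

/-- `T` preserves real-rootedness if it does so up to every positive degree. -/
def PreservesRealRootedness (T : ℝ[X] →ₗ[ℝ] ℝ[X]) : Prop :=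
  ∀ K : ℕ, 1 ≤ K → PreservesRealRootednessUpTo K T

end

/-!
Write `Λ` for the diagonal operator `x ^ n ↦ (1 + α)_n / n! x ^ n` and `M` for
`x ^ j ↦ (-x) ^ j / (1 + α)_j`. The operator attached to `n! L_n^α / (1 + α)_n` is
`p(x) ↦ M (p (x + 1))` (`monomialOp_laguerreUnit`); the one attached to `L_n^α` is that operator
after `Λ`, and the Brenke one is that operator after the diagonal operator `1 / n!`.

Diagonal operators with symbol `1 / (u)_n`, `u > 0`, preserve real-rootedness
(`onlyRealZeros_mulSeq_one_div_poch`): `x ^ n ↦ (n + c) x ^ n` is `p ↦ c p + x p'`, whose zeros are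
controlled by the imaginary part of `c / z + ∑ 1 / (z - r)`, and `1 / (u)_n` is a limit of products
of such symbols. This settles the two normalized families, and the integer case as well, since there
the symbol of `Λ` is a finite product of factors `n + c`.

For non-integral `α` everything depends on `R = ∑ binom(K, n) (-α)_{K-n} x ^ n`.

* By Chu–Vandermonde, `R / K!` is the image of `(1 - x) ^ K`
  (`monomialOp_laguerreL_one_sub_X_pow`). If `α < K - 2`, the top three coefficients of its reversal
  violate Newton's inequality: with `s = K - 2 - α > 0` it would read `s (s + 1) ≤ s ^ 2`.
* If `α > K - 2`, put `u = α - K + 1 > -1`. Then `R` arises from `(1 + x) ^ K` by the symbols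
  `1 / (u + 1)_n` and, up to sign and a constant, `n + u`. The constant `u` may be negative, but at
  that stage all zeros are negative, and then any real `u` is allowed
  (`onlyRealZeros_mulSeq_add_of_neg`). So `R` has only real zeros; by reversal, the symbol `1 / n!`
  and a Pfaff transformation, so does `Λ ((1 + x) ^ K)`, whose coefficients are positive. The
  Schur–Szegő composition theorem (`onlyRealZeros_mulSeq_of_binomPoly`) then shows that `Λ` preserves
  real-rootedness up to degree `K`. It is derived from Grace's theorem, and that from Laguerre's
  theorem on polar derivatives.
-/

/-! ### Pochhammer symbols -/

theorem poch_zero (u : ℝ) : poch u 0 = 1 := by simp [poch]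

theorem poch_succ (u : ℝ) (n : ℕ) : poch u (n + 1) = poch u n * (u + n) := by
  simp [poch, ascPochhammer_succ_eval]

theorem poch_succ_left (u : ℝ) (n : ℕ) : poch u (n + 1) = u * poch (u + 1) n := by
  induction n with
  | zero => simp [poch_succ, poch_zero]
  | succ n ih => rw [poch_succ, ih, poch_succ]; push_cast; ring

theorem poch_add (u : ℝ) (m n : ℕ) : poch u (m + n) = poch u m * poch (u + m) n := by
  induction n with
  | zero => simp [poch_zero]
  | succ n ih => rw [← add_assoc, poch_succ, ih, poch_succ]; push_cast; ring

theorem poch_pos {u : ℝ} (hu : 0 < u) (n : ℕ) : 0 < poch u n := ascPochhammer_pos n u hu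

theorem poch_one (n : ℕ) : poch 1 n = n.factorial := by
  simp [poch]

theorem poch_ne_zero {u : ℝ} {n : ℕ} (hu : ∀ k < n, u + k ≠ 0) : poch u n ≠ 0 := by
  induction n with
  | zero => simp [poch_zero]
  | succ n ih =>
    rw [poch_succ]
    exact mul_ne_zero (ih fun k hk => hu k (by omega)) (hu n (by omega))

/-- The Chu–Vandermonde evaluation of a terminating `₂F₁` at `1`. -/
theorem sum_choose_mul_poch_div_poch (n : ℕ) (a c : ℝ) (hc : 0 < c) :
    ∑ k ∈ Finset.range (n + 1), (-1) ^ k * (n.choose k : ℝ) * (poch a k / poch c k) =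
      poch (c - a) n / poch c n := by
  induction n generalizing a c with
  | zero => simp [poch_zero]
  | succ n ih =>
    have h1 := ih a c hc
    have h2 := ih (a + 1) (c + 1) (by linarith)
    have key : ∑ k ∈ Finset.range (n + 1 + 1),
        (-1) ^ k * ((n + 1).choose k : ℝ) * (poch a k / poch c k) =
        (∑ k ∈ Finset.range (n + 1), (-1) ^ k * (n.choose k : ℝ) * (poch a k / poch c k)) -
        a / c * ∑ k ∈ Finset.range (n + 1),
          (-1) ^ k * (n.choose k : ℝ) * (poch (a + 1) k / poch (c + 1) k) := by
      have e : ∑ k ∈ Finset.range (n + 1), (-1) ^ k * (n.choose k : ℝ) * (poch a k / poch c k) =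
          ∑ k ∈ Finset.range (n + 1 + 1),
            (-1) ^ k * (n.choose k : ℝ) * (poch a k / poch c k) := by
        rw [Finset.sum_range_succ _ (n + 1)]; simp
      rw [e, Finset.sum_range_succ', Finset.sum_range_succ' _ (n + 1), Finset.mul_sum,
        add_sub_right_comm, ← Finset.sum_sub_distrib]
      congr 1
      · refine Finset.sum_congr rfl fun k _ => ?_
        have := (poch_pos (show 0 < c + 1 by linarith) k).ne'
        rw [Nat.choose_succ_succ, poch_succ_left, poch_succ_left]
        push_cast
        field_simp
        ring
      · simp
    rw [key, h1, h2, show c + 1 - (a + 1) = c - a by ring]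
    have hp := (poch_pos (show 0 < c + 1 by linarith) n).ne'
    have hp' := (poch_pos hc n).ne'
    have hcn : c + n ≠ 0 := by positivity
    have e := poch_succ_left c n
    rw [poch_succ] at e
    rw [poch_succ, poch_succ]
    have : poch (c + 1) n = poch c n * (c + n) / c := by
      field_simp; linarith
    rw [this]
    field_simp
    ring

/-! ### Diagonal operators -/

/-- The diagonal operator `x ^ n ↦ γ n * x ^ n` with symbol `γ`. -/
noncomputable def mulSeq (γ : ℕ → ℝ) : ℝ[X] →ₗ[ℝ] ℝ[X] := monomialOp fun n => C (γ n) * X ^ n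

theorem linearMap_ext_X_pow {S T : ℝ[X] →ₗ[ℝ] ℝ[X]} (h : ∀ n, S (X ^ n) = T (X ^ n)) : S = T := by
  ext1 n
  ext1
  simpa [← X_pow_eq_monomial] using h n

theorem coeff_mulSeq (γ : ℕ → ℝ) (p : ℝ[X]) (n : ℕ) :
    (mulSeq γ p).coeff n = γ n * p.coeff n := by
  have : lcoeff ℝ n ∘ₗ mulSeq γ = γ n • lcoeff ℝ n := by
    ext1 k
    ext1
    by_cases hk : n = k
    · simp [← X_pow_eq_monomial, mulSeq, monomialOp_X_pow, hk]
    · simp [← X_pow_eq_monomial, mulSeq, monomialOp_X_pow, coeff_X_pow, hk]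
  simpa using LinearMap.congr_fun this p

theorem mulSeq_mulSeq (γ δ : ℕ → ℝ) (p : ℝ[X]) :
    mulSeq γ (mulSeq δ p) = mulSeq (fun n => γ n * δ n) p := by
  ext n
  simp [coeff_mulSeq, mul_assoc]

theorem degree_mulSeq {γ : ℕ → ℝ} (hγ : ∀ n, γ n ≠ 0) (p : ℝ[X]) :
    (mulSeq γ p).degree = p.degree := by
  have : (mulSeq γ p).support = p.support := by
    ext n
    simp [coeff_mulSeq, hγ]
  simp [degree, this]

theorem natDegree_mulSeq_le (γ : ℕ → ℝ) (p : ℝ[X]) : (mulSeq γ p).natDegree ≤ p.natDegree := by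
  refine natDegree_le_iff_coeff_eq_zero.2 fun n hn => ?_
  rw [coeff_mulSeq, coeff_eq_zero_of_natDegree_lt hn, mul_zero]

/-! ### Polynomials with only real zeros -/

theorem OnlyRealZeros.ne_zero {p : ℝ[X]} (hp : OnlyRealZeros p) : p ≠ 0 := by
  rintro rfl
  simpa using hp Complex.I (by simp)

/-- Since non-real zeros of a real polynomial come in conjugate pairs, only the open upper
half-plane has to be examined. -/
theorem onlyRealZeros_of_upper {p : ℝ[X]} (h : ∀ z : ℂ, 0 < z.im → aeval z p ≠ 0) :
    OnlyRealZeros p := by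
  intro z hz
  by_contra hne
  rcases lt_or_gt_of_ne hne with hlt | hgt
  · refine h (starRingEnd ℂ z) (by simpa using hlt) ?_
    rw [aeval_conj, hz, map_zero]
  · exact h z hgt hz

theorem aeval_eq_eval_map (p : ℝ[X]) (z : ℂ) :
    aeval z p = (p.map (algebraMap ℝ ℂ)).eval z := by
  rw [eval_map_algebraMap]

/-- The logarithmic derivative of a real polynomial as a sum over its complex zeros. -/
theorem aeval_derivative_div_aeval (p : ℝ[X]) {z : ℂ} (hz : aeval z p ≠ 0) :
    aeval z (derivative p) / aeval z p =
      ((p.map (algebraMap ℝ ℂ)).roots.map fun r => 1 / (z - r)).sum := by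
  rw [aeval_eq_eval_map] at hz
  rw [aeval_eq_eval_map, aeval_eq_eval_map, ← derivative_map,
    (IsAlgClosed.splits _).eval_derivative_div_eval_of_ne_zero hz]

theorem OnlyRealZeros.root_im {p : ℝ[X]} (hp : OnlyRealZeros p) {r : ℂ}
    (hr : r ∈ (p.map (algebraMap ℝ ℂ)).roots) : r.im = 0 := by
  refine hp r ?_
  rw [aeval_eq_eval_map]
  exact isRoot_of_mem_roots hr

theorem Complex.multiset_sum_im (s : Multiset ℂ) : s.sum.im = (s.map Complex.im).sum :=
  map_multiset_sum Complex.imAddGroupHom s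

/-! ### Diagonal operators preserving real-rootedness -/

theorem mulSeq_add (c : ℝ) (p : ℝ[X]) :
    mulSeq (fun n => n + c) p = C c * p + X * derivative p := by
  ext n
  rcases n with _ | n
  · simp [coeff_mulSeq]
  · simp [coeff_mulSeq, coeff_X_mul, coeff_derivative]; ring

/-- Every summand `1 / (z - r)` of the logarithmic derivative lies in the lower half-plane. -/
theorem OnlyRealZeros.im_logDeriv_neg {p : ℝ[X]} (hp : OnlyRealZeros p) (hdeg : 0 < p.natDegree)
    {z : ℂ} (hz : 0 < z.im) : (aeval z (derivative p) / aeval z p).im < 0 := by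
  have hpz : aeval z p ≠ 0 := fun h => hz.ne' (hp z h)
  have hne : (p.map (algebraMap ℝ ℂ)).roots ≠ 0 := by
    rw [← Multiset.card_pos, ← (IsAlgClosed.splits _).natDegree_eq_card_roots, natDegree_map]
    exact hdeg
  rw [aeval_derivative_div_aeval p hpz, Complex.multiset_sum_im, Multiset.map_map]
  refine (Multiset.sum_lt_sum_of_nonempty hne (g := fun _ => (0 : ℝ)) fun r hr => ?_).trans_eq
    (by simp)
  have hri := hp.root_im hr
  have hzr : 0 < Complex.normSq (z - r) := by
    refine Complex.normSq_pos.2 fun h => ?_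
    have := congrArg Complex.im h
    simp [hri] at this
    linarith
  rw [Function.comp_apply, one_div, Complex.inv_im, Complex.sub_im, hri, sub_zero]
  exact div_neg_of_neg_of_pos (by linarith) hzr

theorem OnlyRealZeros.derivative {p : ℝ[X]} (hp : OnlyRealZeros p) (hdeg : 0 < p.natDegree) :
    OnlyRealZeros (derivative p) := by
  refine onlyRealZeros_of_upper fun z hz h0 => ?_
  have := hp.im_logDeriv_neg hdeg hz
  simp [h0] at this

theorem onlyRealZeros_mulSeq_add {c : ℝ} (hc : 0 < c) {p : ℝ[X]} (hp : OnlyRealZeros p) :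
    OnlyRealZeros (mulSeq (fun n => n + c) p) := by
  refine onlyRealZeros_of_upper fun z hz h0 => ?_
  have hz0 : z ≠ 0 := by rintro rfl; simp at hz
  have hpz : aeval z p ≠ 0 := fun h => hz.ne' (hp z h)
  have h1 : (c : ℂ) / z + aeval z (Polynomial.derivative p) / aeval z p = 0 := by
    rw [mulSeq_add] at h0
    simp at h0
    field_simp
    linear_combination h0
  have h2 := congrArg Complex.im h1
  have h3 : (aeval z (Polynomial.derivative p) / aeval z p).im ≤ 0 := by
    rcases Nat.eq_zero_or_pos p.natDegree with h | h
    · rw [derivative_of_natDegree_zero h]; simp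
    · exact (hp.im_logDeriv_neg h hz).le
  have h4 : ((c : ℂ) / z).im < 0 := by
    rw [div_eq_mul_inv, Complex.im_ofReal_mul, Complex.inv_im]
    exact mul_neg_of_pos_of_neg hc (div_neg_of_neg_of_pos (by linarith) (Complex.normSq_pos.2 hz0))
  rw [Complex.add_im, Complex.zero_im] at h2
  linarith

/-- When all zeros are negative, `z / (z - r)` has positive imaginary part for `z` in the upper
half-plane, so that the real constant `u` may be arbitrary. -/
theorem onlyRealZeros_mulSeq_add_of_neg (u : ℝ) {p : ℝ[X]} (hp : OnlyRealZeros p)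
    (hneg : ∀ x : ℝ, p.eval x = 0 → x < 0) (hdeg : 0 < p.natDegree) :
    OnlyRealZeros (mulSeq (fun n => n + u) p) := by
  refine onlyRealZeros_of_upper fun z hz h0 => ?_
  have hpz : aeval z p ≠ 0 := fun h => hz.ne' (hp z h)
  have h1 : (u : ℂ) + z * (aeval z (derivative p) / aeval z p) = 0 := by
    rw [mulSeq_add] at h0
    simp at h0
    field_simp
    linear_combination h0
  rw [aeval_derivative_div_aeval p hpz, ← Multiset.sum_map_mul_left] at h1
  have h2 := congrArg Complex.im h1
  rw [Complex.add_im, Complex.multiset_sum_im, Multiset.map_map, Complex.ofReal_im, zero_add,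
    Complex.zero_im] at h2
  have hne : (p.map (algebraMap ℝ ℂ)).roots ≠ 0 := by
    rw [← Multiset.card_pos, ← (IsAlgClosed.splits _).natDegree_eq_card_roots, natDegree_map]
    exact hdeg
  have hlt := Multiset.sum_lt_sum_of_nonempty hne (f := fun _ => (0 : ℝ))
    (g := Complex.im ∘ fun r => z * (1 / (z - r))) fun r hr => ?_
  · simp only [Multiset.map_const', Multiset.sum_replicate, smul_zero] at hlt
    exact hlt.ne' h2
  have hri := hp.root_im hr
  have hrr : r = (r.re : ℂ) := by apply Complex.ext <;> simp [hri]
  have hrn : r.re < 0 := by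
    refine hneg _ ?_
    have := isRoot_of_mem_roots hr
    rw [IsRoot, ← aeval_eq_eval_map, hrr] at this
    rw [← Complex.coe_algebraMap, aeval_algebraMap_apply] at this
    simpa using this
  have hzr : 0 < Complex.normSq (z - r) := by
    refine Complex.normSq_pos.2 fun h => ?_
    have := congrArg Complex.im h
    simp [hri] at this
    linarith
  have : (z * (1 / (z - r))).im = - r.re * z.im / Complex.normSq (z - r) := by
    rw [one_div, Complex.mul_im, Complex.inv_re, Complex.inv_im, Complex.sub_re, Complex.sub_im,
      hri]
    field_simp
    ring
  rw [Function.comp_apply, this]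
  exact div_pos (mul_pos (by linarith) hz) hzr

/-- A polynomial with only real zeros is bounded below off the real axis in terms of its leading
coefficient and degree alone, which makes real-rootedness a closed condition in fixed degree. -/
theorem OnlyRealZeros.le_norm_aeval {p : ℝ[X]} (hp : OnlyRealZeros p) {z : ℂ} (hz : 0 < z.im) :
    |p.leadingCoeff| * z.im ^ p.natDegree ≤ ‖aeval z p‖ := by
  have hs := IsAlgClosed.splits (p.map (algebraMap ℝ ℂ))
  rw [aeval_eq_eval_map, hs.eval_eq_prod_roots, norm_mul, leadingCoeff_map,
    ← natDegree_map (algebraMap ℝ ℂ) (p := p), hs.natDegree_eq_card_roots]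
  refine mul_le_mul (by simp) ?_ (by positivity) (by positivity)
  have key : ∀ s : Multiset ℂ, (∀ r ∈ s, r.im = 0) →
      z.im ^ s.card ≤ ‖(s.map fun r => z - r).prod‖ := by
    intro s
    induction s using Multiset.induction with
    | empty => simp
    | cons a s ih =>
      intro h
      rw [Multiset.map_cons, Multiset.prod_cons, norm_mul, Multiset.card_cons, pow_succ']
      refine mul_le_mul ?_ (ih fun r hr => h r (Multiset.mem_cons_of_mem hr)) (by positivity)
        (norm_nonneg _)
      have h1 := Complex.abs_im_le_norm (z - a)
      rw [Complex.sub_im, h a (Multiset.mem_cons_self a s), sub_zero] at h1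
      exact (le_abs_self _).trans h1
  exact key _ fun r hr => hp.root_im hr

/-- In fixed degree, real-rootedness passes to limits of the symbol. -/
theorem onlyRealZeros_mulSeq_of_tendsto {γ : ℕ → ℕ → ℝ} {δ : ℕ → ℝ}
    (hγ : ∀ n, Filter.Tendsto (fun N => γ N n) Filter.atTop (nhds (δ n))) (hδ : ∀ n, δ n ≠ 0)
    {p : ℝ[X]} (h : ∀ᶠ N in Filter.atTop, OnlyRealZeros (mulSeq (γ N) p))
    (hp : p ≠ 0) : OnlyRealZeros (mulSeq δ p) := by
  refine onlyRealZeros_of_upper fun z hz h0 => ?_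
  have hev : ∀ η : ℕ → ℝ, aeval z (mulSeq η p) =
      ∑ n ∈ Finset.range (p.natDegree + 1), ((η n * p.coeff n : ℝ) : ℂ) * z ^ n := by
    intro η
    rw [aeval_eq_sum_range' (Nat.lt_succ_of_le (natDegree_mulSeq_le η p))]
    simp [coeff_mulSeq]
  have ht : Filter.Tendsto (fun N => ‖aeval z (mulSeq (γ N) p)‖) Filter.atTop
      (nhds ‖aeval z (mulSeq δ p)‖) := by
    simp only [hev]
    refine (tendsto_finsetSum _ fun n _ => ?_).norm
    refine Filter.Tendsto.mul_const _ ?_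
    exact (Complex.continuous_ofReal.tendsto _).comp ((hγ n).mul_const _)
  have hl : Filter.Tendsto (fun N => |γ N p.natDegree * p.leadingCoeff| * z.im ^ p.natDegree)
      Filter.atTop (nhds (|δ p.natDegree * p.leadingCoeff| * z.im ^ p.natDegree)) :=
    (((hγ _).mul_const _).abs).mul_const _
  have hle : |δ p.natDegree * p.leadingCoeff| * z.im ^ p.natDegree ≤
      ‖aeval z (mulSeq δ p)‖ := by
    refine le_of_tendsto_of_tendsto hl ht ?_
    filter_upwards [h, (hγ p.natDegree).eventually_ne (hδ _)] with N hN hne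
    have hd : (mulSeq (γ N) p).natDegree = p.natDegree := by
      refine le_antisymm (natDegree_mulSeq_le _ _) (le_natDegree_of_ne_zero ?_)
      rw [coeff_mulSeq]
      exact mul_ne_zero hne (leadingCoeff_ne_zero.2 hp)
    have := hN.le_norm_aeval hz
    rwa [leadingCoeff, hd, coeff_mulSeq] at this
  rw [h0, norm_zero] at hle
  have : 0 < |δ p.natDegree * p.leadingCoeff| * z.im ^ p.natDegree :=
    mul_pos (abs_pos.2 (mul_ne_zero (hδ _) (leadingCoeff_ne_zero.2 hp))) (pow_pos hz _)
  linarith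

theorem OnlyRealZeros.C_mul {p : ℝ[X]} (hp : OnlyRealZeros p) {c : ℝ} (hc : c ≠ 0) :
    OnlyRealZeros (C c * p) := by
  intro z hz
  rw [map_mul, aeval_C] at hz
  exact hp z ((mul_eq_zero.1 hz).resolve_left (by simpa using hc))

theorem mulSeq_const (c : ℝ) (p : ℝ[X]) : mulSeq (fun _ => c) p = C c * p := by
  ext n
  simp [coeff_mulSeq]

theorem mulSeq_pow (c : ℝ) (p : ℝ[X]) : mulSeq (fun n => c ^ n) p = p.comp (C c * X) := by
  ext n
  rw [coeff_mulSeq, comp_C_mul_X_coeff, mul_comm]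

theorem OnlyRealZeros.mulSeq_pow {p : ℝ[X]} (hp : OnlyRealZeros p) {c : ℝ} (hc : c ≠ 0) :
    OnlyRealZeros (mulSeq (fun n => c ^ n) p) := by
  intro z hz
  rw [_root_.mulSeq_pow, aeval_comp] at hz
  have := hp _ hz
  simpa [hc] using this

/-- `(u + N)_n / (u)_n` is the product over `k < N` of the factors `(n + u + k) / (u + k)`. -/
theorem onlyRealZeros_mulSeq_poch_div {u : ℝ} (hu : 0 < u) {p : ℝ[X]} (hp : OnlyRealZeros p)
    (N : ℕ) : OnlyRealZeros (mulSeq (fun n => poch (u + N) n / poch u n) p) := by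
  induction N with
  | zero =>
    have : (fun n => poch (u + (0 : ℕ)) n / poch u n) = fun _ => (1 : ℝ) := by
      funext n
      simp [(poch_pos hu n).ne']
    rw [this, mulSeq_const]
    simpa using hp
  | succ N ih =>
    have hN : 0 < u + N := by positivity
    have := (onlyRealZeros_mulSeq_add hN ih).C_mul (inv_ne_zero hN.ne')
    rw [mulSeq_mulSeq, ← mulSeq_const, mulSeq_mulSeq] at this
    convert this using 4 with n
    have e := poch_succ_left (u + N) n
    rw [poch_succ] at e
    have := (poch_pos hu n).ne'
    push_cast
    rw [← add_assoc]
    field_simp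
    linarith

theorem tendsto_poch_div_pow (u : ℝ) (n : ℕ) :
    Filter.Tendsto (fun N : ℕ => poch (u + (N + 1 : ℕ)) n * ((N + 1 : ℝ)⁻¹) ^ n)
      Filter.atTop (nhds 1) := by
  induction n with
  | zero => simp [poch_zero]
  | succ n ih =>
    have h : Filter.Tendsto (fun N : ℕ => (u + n) * (N + 1 : ℝ)⁻¹ + 1)
        Filter.atTop (nhds ((u + n) * 0 + 1)) := by
      refine ((Filter.Tendsto.const_mul _ ?_).add_const _)
      simpa using tendsto_one_div_add_atTop_nhds_zero_nat (𝕜 := ℝ)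
    have h2 := ih.mul h
    simp only [mul_zero, zero_add, one_mul] at h2
    refine h2.congr fun N => ?_
    rw [poch_succ, pow_succ]
    have : (N + 1 : ℝ) ≠ 0 := by positivity
    push_cast
    field_simp
    ring

/-- `1 / (u)_n` is a multiplier sequence for `u > 0`: by Euler's product it is the limit of
`(u + N)_n / ((u)_n N ^ n)`. -/
theorem onlyRealZeros_mulSeq_one_div_poch {u : ℝ} (hu : 0 < u) {p : ℝ[X]}
    (hp : OnlyRealZeros p) : OnlyRealZeros (mulSeq (fun n => 1 / poch u n) p) := by
  refine onlyRealZeros_mulSeq_of_tendsto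
    (γ := fun N n => ((N + 1 : ℝ)⁻¹) ^ n * (poch (u + (N + 1 : ℕ)) n / poch u n))
    (fun n => ?_) (fun n => one_div_ne_zero (poch_pos hu n).ne')
    (Filter.Eventually.of_forall fun N => ?_) hp.ne_zero
  · refine ((tendsto_poch_div_pow u n).div_const (poch u n)).congr fun N => ?_
    ring
  · rw [← mulSeq_mulSeq]
    refine (onlyRealZeros_mulSeq_poch_div hu hp (N + 1)).mulSeq_pow ?_
    positivity

/-! ### Laguerre's theorem on polar derivatives -/

/-- The disc which is the image of the lower half-plane under `r ↦ (ζ - r) / (w - r)` lies in an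
open half-plane with `0` on its boundary, the one in the direction `-i (ζ - conj w)`. The factor on
the left is the conjugate of this direction. -/
theorem re_conj_mul_div_pos {ζ w r : ℂ} (hζ : 0 < ζ.im) (hw : 0 < w.im) (hr : r.im ≤ 0) :
    0 < (⟨ζ.im + w.im, ζ.re - w.re⟩ * ((ζ - r) / (w - r)) : ℂ).re := by
  have hn : 0 < Complex.normSq (w - r) := by
    refine Complex.normSq_pos.2 fun h => ?_
    have := congrArg Complex.im h
    simp at this
    linarith
  obtain ⟨a, b⟩ := ζ
  obtain ⟨c, e⟩ := w
  obtain ⟨f, g⟩ := r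
  simp only at hζ hw hr
  have key : 0 < (b - g) * (e - g) * (b + e) + (-g) * ((a - f) - (c - f)) ^ 2 + e * (a - f) ^ 2 +
      b * (c - f) ^ 2 := by
    have : 0 < (b - g) * (e - g) * (b + e) :=
      mul_pos (mul_pos (by linarith) (by linarith)) (by linarith)
    have : 0 ≤ (-g) * ((a - f) - (c - f)) ^ 2 := mul_nonneg (by linarith) (sq_nonneg _)
    positivity
  have : (⟨b + e, a - c⟩ * ((⟨a, b⟩ - ⟨f, g⟩) / (⟨c, e⟩ - ⟨f, g⟩)) : ℂ).re =
      ((b - g) * (e - g) * (b + e) + (-g) * ((a - f) - (c - f)) ^ 2 + e * (a - f) ^ 2 +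
      b * (c - f) ^ 2) / Complex.normSq (⟨c, e⟩ - ⟨f, g⟩) := by
    simp only [Complex.mul_re, Complex.div_re, Complex.div_im, Complex.sub_re, Complex.sub_im]
    field_simp
    ring
  rw [this]
  exact div_pos key hn

/-- **Laguerre's theorem** on polar derivatives, for the upper half-plane; `n` is the formal
degree, so that zeros at infinity are allowed. -/
theorem laguerre_polar_derivative {F : ℂ[X]} {n : ℕ} (hn : 0 < n) (hdeg : F.natDegree ≤ n)
    (hF : ∀ w : ℂ, 0 < w.im → F.eval w ≠ 0) {ζ w : ℂ} (hζ : 0 < ζ.im) (hw : 0 < w.im) :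
    n * F.eval w + (ζ - w) * (derivative F).eval w ≠ 0 := by
  intro h0
  have hs := IsAlgClosed.splits F
  have hroot : ∀ r ∈ F.roots, r.im ≤ 0 := fun r hr => by
    by_contra! h
    exact hF r h (isRoot_of_mem_roots hr)
  -- Divided by `F w`, the claim concerns a sum of the numbers `(ζ - r) / (w - r)`, and of `1` for
  -- each zero at infinity; all of them have positive real part after multiplication by `q`.
  set q : ℂ := ⟨ζ.im + w.im, ζ.re - w.re⟩ with hq
  have h1 : (n - F.natDegree : ℂ) + (F.roots.map fun r => (ζ - r) / (w - r)).sum = 0 := by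
    have e1 : (F.roots.map fun r => (ζ - r) / (w - r)).sum =
        F.natDegree + (ζ - w) * (F.roots.map fun r => 1 / (w - r)).sum := by
      have : (F.roots.map fun r => (ζ - r) / (w - r)) =
          F.roots.map fun r => 1 + (ζ - w) * (1 / (w - r)) := by
        refine Multiset.map_congr rfl fun r hr => ?_
        have : w - r ≠ 0 := by
          intro h
          have := congrArg Complex.im h
          have := hroot r hr
          simp at *
          linarith
        field_simp
        ring
      rw [this, Multiset.sum_map_add, Multiset.sum_map_mul_left, hs.natDegree_eq_card_roots]
      simp
    rw [e1, ← hs.eval_derivative_div_eval_of_ne_zero (hF w hw)]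
    have := hF w hw
    field_simp
    linear_combination h0
  have h2 := congrArg (fun x => (q * x).re) h1
  simp only [mul_add, Complex.add_re, mul_zero, Complex.zero_re] at h2
  rw [← Multiset.sum_map_mul_left, ← Complex.coe_reAddGroupHom, map_multiset_sum,
    Multiset.map_map] at h2
  have hq1 : Complex.reAddGroupHom (q * (n - F.natDegree : ℂ)) =
      (ζ.im + w.im) * (n - F.natDegree : ℝ) := by
    simp [hq]
  rw [hq1] at h2
  have hnd : (0 : ℝ) ≤ n - F.natDegree := sub_nonneg.2 (by exact_mod_cast hdeg)
  have h3 : 0 ≤ (ζ.im + w.im) * (n - F.natDegree : ℝ) := mul_nonneg (by linarith) hnd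
  by_cases hz : F.roots = 0
  · have : F.natDegree = 0 := by rw [hs.natDegree_eq_card_roots, hz]; rfl
    rw [hz, this] at h2
    have : (0 : ℝ) < n := by exact_mod_cast hn
    have := mul_pos (show 0 < ζ.im + w.im by linarith) this
    simp at h2
    rcases h2 with h2 | h2
    · linarith
    · omega
  · have hlt := Multiset.sum_lt_sum_of_nonempty hz (f := fun _ => (0 : ℝ))
      (g := Complex.reAddGroupHom ∘ fun r => q * ((ζ - r) / (w - r))) fun r hr =>
        re_conj_mul_div_pos hζ hw (hroot r hr)
    simp only [Multiset.map_const', Multiset.sum_replicate, smul_zero] at hlt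
    linarith

/-! ### Binomially normalized coefficients -/

/-- The polynomial `∑ n, binom(m, n) a_n X ^ n` of formal degree `m` with binomially normalized
coefficients `a`. -/
noncomputable def binomPoly {R : Type*} [CommSemiring R] (m : ℕ) (a : ℕ → R) : R[X] :=
  ∑ n ∈ Finset.range (m + 1), C (m.choose n * a n) * X ^ n

theorem coeff_binomPoly {R : Type*} [CommSemiring R] (m : ℕ) (a : ℕ → R) (n : ℕ) :
    (binomPoly m a).coeff n = m.choose n * a n := by
  simp only [binomPoly, finsetSum_coeff, coeff_C_mul_X_pow]
  rw [Finset.sum_ite_eq]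
  split_ifs with h
  · rfl
  · rw [Nat.choose_eq_zero_of_lt (by simpa using h)]; simp

theorem natDegree_binomPoly_le {R : Type*} [CommSemiring R] (m : ℕ) (a : ℕ → R) :
    (binomPoly m a).natDegree ≤ m := by
  refine natDegree_le_iff_coeff_eq_zero.2 fun n hn => ?_
  rw [coeff_binomPoly, Nat.choose_eq_zero_of_lt hn]
  simp

theorem derivative_binomPoly {R : Type*} [CommRing R] (m : ℕ) (a : ℕ → R) :
    derivative (binomPoly (m + 1) a) = C (m + 1 : R) * binomPoly m fun n => a (n + 1) := by
  ext n
  rw [coeff_derivative, coeff_C_mul, coeff_binomPoly, coeff_binomPoly]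
  have := congrArg (Nat.cast (R := R)) (Nat.add_one_mul_choose_eq m n)
  push_cast at this
  linear_combination (-a (n + 1)) * this

/-! ### Grace's theorem and the Schur–Szegő composition -/

theorem eval_binomPoly_functional {R : Type*} [CommRing R] (φ : R[X] →ₗ[R] R) (m : ℕ) (x : R) :
    (binomPoly m fun n => φ (X ^ n)).eval x = φ ((1 + C x * X) ^ m) := by
  rw [add_comm, add_pow, map_sum, binomPoly, eval_finsetSum]
  refine Finset.sum_congr rfl fun n _ => ?_
  have e : (C x * X) ^ n * 1 ^ (m - n) * (m.choose n : R[X]) = (m.choose n * x ^ n : R) • X ^ n := by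
    rw [smul_eq_C_mul, C_mul, C_pow, C_eq_natCast, mul_pow, one_pow]
    ring
  rw [e, map_smul]
  simp
  ring

theorem eval_binomPoly_functional_succ {R : Type*} [CommRing R] (φ : R[X] →ₗ[R] R) (m : ℕ)
    (x : R) : (binomPoly m fun n => φ (X ^ (n + 1))).eval x = φ (X * (1 + C x * X) ^ m) := by
  have := eval_binomPoly_functional (φ ∘ₗ LinearMap.mulLeft R X) m x
  simpa [pow_succ'] using this

/-- **Grace's theorem** in Walsh's form: if the polynomial `x ↦ φ ((1 + x Y) ^ m)` has no zero in
the upper half-plane, neither has its symmetric multiaffine polarization. Each step replaces one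
factor `1 + x Y` by `1 + ζ Y`, which is a polar derivative. -/
theorem functional_prod_ne_zero (s : Multiset ℂ) (hs : ∀ ζ ∈ s, 0 < ζ.im) (φ : ℂ[X] →ₗ[ℂ] ℂ)
    (hφ : ∀ x : ℂ, 0 < x.im → φ ((1 + C x * X) ^ s.card) ≠ 0) :
    φ (s.map fun ζ => 1 + C ζ * X).prod ≠ 0 := by
  induction s using Multiset.induction generalizing φ with
  | empty => simpa using hφ Complex.I (by simp)
  | cons ζ s ih =>
    rw [Multiset.map_cons, Multiset.prod_cons]
    refine ih (fun ξ hξ => hs ξ (Multiset.mem_cons_of_mem hξ))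
      (φ ∘ₗ LinearMap.mulLeft ℂ (1 + C ζ * X)) fun x hx => ?_
    rw [Multiset.card_cons] at hφ
    have h := laguerre_polar_derivative (n := s.card + 1) (Nat.succ_pos _)
      (natDegree_binomPoly_le (s.card + 1) fun n => φ (X ^ n))
      (fun w hw => by rw [eval_binomPoly_functional]; exact hφ w hw)
      (hs ζ (Multiset.mem_cons_self ζ s)) hx
    rw [derivative_binomPoly, eval_mul, eval_C, eval_binomPoly_functional,
      eval_binomPoly_functional_succ] at h
    intro h0
    apply h
    have e : (1 + C ζ * X) * (1 + C x * X) ^ s.card =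
        (1 + C x * X) ^ (s.card + 1) + (ζ - x) • (X * (1 + C x * X) ^ s.card) := by
      rw [smul_eq_C_mul, C_sub]; ring
    rw [LinearMap.comp_apply, LinearMap.mulLeft_apply, e, map_add, map_smul, smul_eq_mul] at h0
    push_cast
    linear_combination (s.card + 1 : ℂ) * h0

/-- The **Schur–Szegő composition** theorem: if `∑ binom(K, n) γ_n X ^ n` has degree `K` and only
negative zeros, then `γ` preserves real-rootedness up to degree `K`. -/
theorem onlyRealZeros_mulSeq_of_binomPoly {K : ℕ} {γ : ℕ → ℝ} (h0 : γ 0 = 1) (hK : γ K ≠ 0)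
    (hreal : OnlyRealZeros (binomPoly K γ)) (hneg : ∀ x : ℝ, (binomPoly K γ).eval x = 0 → x < 0)
    {p : ℝ[X]} (hp : OnlyRealZeros p) (hdeg : p.natDegree ≤ K) :
    OnlyRealZeros (mulSeq γ p) := by
  refine onlyRealZeros_of_upper fun z hz => ?_
  set g := (binomPoly K γ).map (algebraMap ℝ ℂ) with hg
  have hs := IsAlgClosed.splits g
  have hgd : g.natDegree = K := by
    rw [hg, natDegree_map]
    refine le_antisymm (natDegree_binomPoly_le _ _) (le_natDegree_of_ne_zero ?_)
    simpa [coeff_binomPoly] using hK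
  have hroot : ∀ r ∈ g.roots, ∃ x : ℝ, x < 0 ∧ r = x := fun r hr => by
    have hr' : r = (r.re : ℂ) := by apply Complex.ext <;> simp [hreal.root_im hr]
    refine ⟨r.re, hneg _ ?_, hr'⟩
    have := isRoot_of_mem_roots hr
    rw [IsRoot, hg, ← aeval_eq_eval_map, hr', ← Complex.coe_algebraMap,
      aeval_algebraMap_apply] at this
    simpa using this
  -- `∏ (1 + ζ Y)` over the `ζ = -z / r` is `g (z Y)`, because `g 0 = 1`.
  set s : Multiset ℂ := g.roots.map fun r => -z / r with hs'
  have hcard : s.card = K := by rw [hs', Multiset.card_map, ← hs.natDegree_eq_card_roots, hgd]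
  have hprod : (s.map fun ζ => 1 + C ζ * X).prod = g.comp (C z * X) := by
    have hg0 : g.eval 0 = 1 := by
      rw [hg, ← coeff_zero_eq_eval_zero, coeff_map, coeff_binomPoly]
      simp [h0]
    have e1 : (s.map fun ζ => 1 + C ζ * X).prod =
        C (g.roots.map fun r => (-r)⁻¹).prod * (g.roots.map fun r => C z * X - C r).prod := by
      rw [hs', Multiset.map_map, ← Multiset.prod_hom _ (C : ℂ →+* ℂ[X]), Multiset.map_map,
        ← Multiset.prod_map_mul]
      refine congrArg Multiset.prod (Multiset.map_congr rfl fun r hr => ?_)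
      obtain ⟨x, hx, rfl⟩ := hroot r hr
      have hx0 : (x : ℂ) ≠ 0 := by exact_mod_cast hx.ne
      simp only [Function.comp_apply]
      rw [mul_sub, ← mul_assoc, ← C_mul, ← C_mul, sub_eq_add_neg, ← C_neg, add_comm]
      congr 1
      · congr 2
        field_simp
      · rw [show -((-(x : ℂ))⁻¹ * x) = 1 by field_simp, C_1]
    have e2 : g.comp (C z * X) =
        C g.leadingCoeff * (g.roots.map fun r => C z * X - C r).prod := by
      conv_lhs => rw [hs.eq_prod_roots]
      rw [mul_comp, C_comp, multiset_prod_comp, Multiset.map_map]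
      simp
    rw [e1, e2]
    congr 2
    rw [hs.eval_eq_prod_roots] at hg0
    rw [Multiset.prod_map_inv, eq_comm]
    simp only [zero_sub] at hg0
    exact eq_inv_of_mul_eq_one_left hg0
  -- This functional sends `(1 + x Y) ^ K` to `p x` and `g (z Y)` to the value at `z` of the image.
  let φ : ℂ[X] →ₗ[ℂ] ℂ :=
    ∑ n ∈ Finset.range (K + 1), ((p.coeff n : ℂ) / (K.choose n : ℂ)) • lcoeff ℂ n
  have hφ : ∀ G : ℂ[X], φ G =
      ∑ n ∈ Finset.range (K + 1), ((p.coeff n : ℂ) / (K.choose n : ℂ)) * G.coeff n := fun G => by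
    simp [φ]
  have hch : ∀ n ∈ Finset.range (K + 1), (K.choose n : ℂ) ≠ 0 := fun n hn => by
    exact_mod_cast (Nat.choose_pos (by simpa [Nat.lt_succ_iff] using hn)).ne'
  have key := functional_prod_ne_zero s (fun ζ hζ => ?_) φ fun x hx => ?_
  · rw [hprod, hφ] at key
    convert key using 1
    rw [aeval_eq_sum_range' (Nat.lt_succ_of_le ((natDegree_mulSeq_le γ p).trans hdeg))]
    refine Finset.sum_congr rfl fun n hn => ?_
    have := hch n hn
    rw [comp_C_mul_X_coeff, hg, coeff_map, coeff_binomPoly, coeff_mulSeq]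
    simp
    field_simp
  · obtain ⟨r, hr, rfl⟩ := Multiset.mem_map.1 hζ
    obtain ⟨x, hx, rfl⟩ := hroot r hr
    rw [Complex.div_ofReal_im, Complex.neg_im]
    exact div_pos_of_neg_of_neg (by linarith) hx
  · rw [hcard, hφ]
    have hpx : aeval x p ≠ 0 := fun h => hx.ne' (hp x h)
    convert hpx using 1
    rw [aeval_eq_sum_range' (Nat.lt_succ_of_le hdeg)]
    refine Finset.sum_congr rfl fun n hn => ?_
    have := hch n hn
    have e : ((1 + C x * X) ^ K : ℂ[X]) = ((1 + X) ^ K : ℂ[X]).comp (C x * X) := by simp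
    rw [e, comp_C_mul_X_coeff, coeff_one_add_X_pow]
    simp
    field_simp

/-! ### Real-rootedness in terms of binomially normalized coefficients -/

theorem binomPoly_congr {R : Type*} [CommSemiring R] {m : ℕ} {a b : ℕ → R}
    (h : ∀ n ≤ m, a n = b n) : binomPoly m a = binomPoly m b := by
  refine Finset.sum_congr rfl fun n hn => ?_
  rw [h n (by simpa [Nat.lt_succ_iff] using hn)]

theorem mulSeq_binomPoly (γ : ℕ → ℝ) (m : ℕ) (a : ℕ → ℝ) :
    mulSeq γ (binomPoly m a) = binomPoly m fun n => γ n * a n := by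
  ext n
  simp only [coeff_mulSeq, coeff_binomPoly]
  ring

theorem one_add_X_pow_eq_binomPoly (m : ℕ) : (1 + X : ℝ[X]) ^ m = binomPoly m fun _ => 1 := by
  ext n
  rw [coeff_one_add_X_pow, coeff_binomPoly, mul_one]

theorem one_sub_X_pow_eq_binomPoly (m : ℕ) :
    (1 - X : ℝ[X]) ^ m = binomPoly m fun n => (-1) ^ n := by
  have : (1 - X : ℝ[X]) ^ m = mulSeq (fun n => (-1) ^ n) ((1 + X) ^ m) := by
    rw [mulSeq_pow]
    simp [sub_eq_add_neg]
  rw [this, one_add_X_pow_eq_binomPoly, mulSeq_binomPoly]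
  simp

theorem onlyRealZeros_one_add_X_pow (m : ℕ) : OnlyRealZeros ((1 + X) ^ m) := by
  intro z hz
  have h : 1 + z = 0 := by
    rw [map_pow] at hz
    simpa using eq_zero_of_pow_eq_zero hz
  have := congrArg Complex.im h
  simpa using this

theorem aeval_binomPoly (m : ℕ) (a : ℕ → ℝ) (z : ℂ) :
    aeval z (binomPoly m a) = ∑ n ∈ Finset.range (m + 1), (m.choose n : ℂ) * a n * z ^ n := by
  simp [binomPoly]

theorem natDegree_binomPoly {m : ℕ} {a : ℕ → ℝ} (h : a m ≠ 0) :
    (binomPoly m a).natDegree = m := by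
  refine le_antisymm (natDegree_binomPoly_le _ _) (le_natDegree_of_ne_zero ?_)
  simpa [coeff_binomPoly] using h

theorem eval_binomPoly_pos {m : ℕ} {a : ℕ → ℝ} (h : ∀ n, 0 < a n) {x : ℝ} (hx : 0 ≤ x) :
    0 < (binomPoly m a).eval x := by
  rw [binomPoly, eval_finsetSum]
  refine Finset.sum_pos' (fun n _ => ?_) ⟨0, by simp, by simpa using h 0⟩
  have := (h n).le
  simp only [eval_mul, eval_C, eval_pow, eval_X]
  positivity

theorem OnlyRealZeros.reverse_binomPoly {m : ℕ} {a : ℕ → ℝ} (h : OnlyRealZeros (binomPoly m a)) :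
    OnlyRealZeros (binomPoly m fun n => a (m - n)) := by
  refine onlyRealZeros_of_upper fun z hz h0 => ?_
  have hz0 : z ≠ 0 := by rintro rfl; simp at hz
  have hinv : (z⁻¹).im ≠ 0 := by
    rw [Complex.inv_im]
    exact div_ne_zero (by linarith) (Complex.normSq_pos.2 hz0).ne'
  refine hinv (h _ ?_)
  rw [aeval_binomPoly, ← Finset.sum_flip] at h0
  rw [aeval_binomPoly]
  refine (mul_eq_zero.1 (?_ : z ^ m * _ = 0)).resolve_left (pow_ne_zero m hz0)
  rw [← h0, Finset.mul_sum]
  refine Finset.sum_congr rfl fun n hn => ?_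
  have hn : n ≤ m := by simpa [Nat.lt_succ_iff] using hn
  obtain ⟨k, rfl⟩ := Nat.exists_eq_add_of_le hn
  rw [Nat.choose_symm hn, Nat.sub_sub_self hn, Nat.add_sub_cancel_left, pow_add, inv_pow]
  field_simp

/-- Shifting normalized coefficients amounts to differentiating. -/
theorem OnlyRealZeros.shift_binomPoly {m : ℕ} {a : ℕ → ℝ} (k : ℕ) (ha : a (m + k) ≠ 0)
    (hm : 0 < m) (h : OnlyRealZeros (binomPoly (m + k) a)) :
    OnlyRealZeros (binomPoly m fun n => a (k + n)) := by
  induction k generalizing a with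
  | zero => simpa using h
  | succ k ih =>
    have h1 := h.derivative (by rw [natDegree_binomPoly ha]; omega)
    rw [← add_assoc, derivative_binomPoly] at h1
    have hmk : ((m + k : ℕ) + 1 : ℝ) ≠ 0 := by positivity
    have h2 := h1.C_mul (inv_ne_zero hmk)
    rw [← mul_assoc, ← Polynomial.C_mul, inv_mul_cancel₀ hmk, C_1, one_mul] at h2
    have := ih (a := fun n => a (n + 1)) (by simpa [add_assoc] using ha) h2
    convert this using 4
    omega

/-- **Newton's inequality** for the three leading coefficients. -/
theorem OnlyRealZeros.newton_binomPoly {k : ℕ} {a : ℕ → ℝ} (ha : a (2 + k) ≠ 0)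
    (h : OnlyRealZeros (binomPoly (2 + k) a)) : a k * a (k + 2) ≤ a (k + 1) ^ 2 := by
  have h2 := h.shift_binomPoly k ha (by norm_num)
  have hdeg : (binomPoly 2 fun n => a (k + n)).natDegree = 2 :=
    natDegree_binomPoly (by simpa [add_comm] using ha)
  -- A real zero of `a_k + 2 a_{k+1} x + a_{k+2} x ^ 2` bounds its discriminant.
  obtain ⟨z, hz⟩ := IsAlgClosed.exists_aeval_eq_zero ℂ (binomPoly 2 fun n => a (k + n))
    (by rw [degree_eq_natDegree h2.ne_zero, hdeg]; norm_num)
  have hz' : z = (z.re : ℂ) := by apply Complex.ext <;> simp [h2 z hz]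
  rw [aeval_binomPoly, hz'] at hz
  simp [Finset.sum_range_succ] at hz
  have hz2 : a k + 2 * a (k + 1) * z.re + a (k + 2) * z.re ^ 2 = 0 := by
    apply Complex.ofReal_injective
    push_cast
    linear_combination hz
  have := sq_nonneg (a (k + 2) * z.re + a (k + 1))
  linear_combination this + a (k + 2) * hz2

/-! ### Factorization of the Laguerre operators -/

theorem coeff_laguerreL (α : ℝ) (n j : ℕ) :
    (laguerreL α n).coeff j = if j ≤ n then
      (-1) ^ j * poch (α + j + 1) (n - j) / ((j.factorial : ℝ) * ((n - j).factorial : ℝ))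
      else 0 := by
  simp only [laguerreL, finsetSum_coeff, coeff_C_mul_X_pow]
  rw [Finset.sum_ite_eq]
  simp

theorem mulSeq_X_pow (γ : ℕ → ℝ) (n : ℕ) : mulSeq γ (X ^ n) = γ n • X ^ n := by
  rw [mulSeq, monomialOp_X_pow, smul_eq_C_mul]

/-- The operator for `n! L_n^α / (1 + α)_n` is the translation `p(x) ↦ p(x + 1)` followed by a
diagonal operator. -/
theorem monomialOp_laguerreUnit {α : ℝ} (hα : -1 < α) (p : ℝ[X]) :
    monomialOp (laguerreUnit α) p =
      mulSeq (fun j => (-1) ^ j * (1 / poch (1 + α) j)) (taylor 1 p) := by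
  have : monomialOp (laguerreUnit α) =
      mulSeq (fun j => (-1) ^ j * (1 / poch (1 + α) j)) ∘ₗ taylor 1 := by
    refine linearMap_ext_X_pow fun n => ?_
    rw [monomialOp_X_pow, LinearMap.comp_apply]
    ext j
    rw [taylor_apply, X_pow_comp, C_1, coeff_mulSeq, coeff_X_add_one_pow, laguerreUnit,
      coeff_C_mul, coeff_laguerreL]
    split_ifs with hj
    · obtain ⟨k, rfl⟩ := Nat.exists_eq_add_of_le hj
      have h1 := (poch_pos (show 0 < 1 + α by linarith) j).ne'
      have hj0 : (0 : ℝ) ≤ j := Nat.cast_nonneg j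
      have h2 := (poch_pos (show 0 < 1 + α + j by linarith) k).ne'
      rw [poch_add, Nat.add_sub_cancel_left, show α + j + 1 = 1 + α + j by ring,
        Nat.cast_choose ℝ hj, Nat.add_sub_cancel_left]
      field_simp
    · rw [Nat.choose_eq_zero_of_lt (by omega)]; simp
  rw [this, LinearMap.comp_apply]

theorem monomialOp_laguerreL {α : ℝ} (hα : -1 < α) (p : ℝ[X]) :
    monomialOp (laguerreL α) p =
      monomialOp (laguerreUnit α) (mulSeq (fun n => poch (1 + α) n / poch 1 n) p) := by
  have : monomialOp (laguerreL α) =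
      monomialOp (laguerreUnit α) ∘ₗ mulSeq (fun n => poch (1 + α) n / poch 1 n) := by
    refine linearMap_ext_X_pow fun n => ?_
    rw [LinearMap.comp_apply, mulSeq_X_pow, map_smul, monomialOp_X_pow, monomialOp_X_pow,
      laguerreUnit, smul_eq_C_mul, ← mul_assoc, ← C_mul, poch_one]
    have h1 := (poch_pos (show 0 < 1 + α by linarith) n).ne'
    rw [show poch (1 + α) n / (n.factorial : ℝ) * (n.factorial / poch (1 + α) n) = 1 by
      field_simp, C_1, one_mul]
  rw [this, LinearMap.comp_apply]

theorem monomialOp_laguerreBrenke (α : ℝ) (p : ℝ[X]) :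
    monomialOp (laguerreBrenke α) p =
      monomialOp (laguerreUnit α) (mulSeq (fun n => 1 / poch 1 n) p) := by
  have : monomialOp (laguerreBrenke α) =
      monomialOp (laguerreUnit α) ∘ₗ mulSeq (fun n => 1 / poch 1 n) := by
    refine linearMap_ext_X_pow fun n => ?_
    rw [LinearMap.comp_apply, mulSeq_X_pow, map_smul, monomialOp_X_pow, monomialOp_X_pow,
      laguerreUnit, laguerreBrenke, smul_eq_C_mul, ← mul_assoc, ← C_mul, poch_one]
    congr 2
    field_simp
  rw [this, LinearMap.comp_apply]

theorem degree_monomialOp_laguerreUnit {α : ℝ} (hα : -1 < α) (p : ℝ[X]) :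
    (monomialOp (laguerreUnit α) p).degree = p.degree := by
  rw [monomialOp_laguerreUnit hα, degree_mulSeq, degree_taylor]
  intro n
  have := (poch_pos (show 0 < 1 + α by linarith) n).ne'
  exact mul_ne_zero (pow_ne_zero _ (by norm_num)) (one_div_ne_zero this)

theorem onlyRealZeros_monomialOp_laguerreUnit {α : ℝ} (hα : -1 < α) {p : ℝ[X]}
    (hp : OnlyRealZeros p) : OnlyRealZeros (monomialOp (laguerreUnit α) p) := by
  rw [monomialOp_laguerreUnit hα, ← mulSeq_mulSeq]
  refine (onlyRealZeros_mulSeq_one_div_poch (by linarith) ?_).mulSeq_pow (by norm_num)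
  intro z hz
  rw [taylor_apply, aeval_comp] at hz
  simpa using hp _ hz

theorem degree_monomialOp_laguerreL {α : ℝ} (hα : -1 < α) (p : ℝ[X]) :
    (monomialOp (laguerreL α) p).degree = p.degree := by
  rw [monomialOp_laguerreL hα, degree_monomialOp_laguerreUnit hα, degree_mulSeq]
  exact fun n => div_ne_zero (poch_pos (by linarith) n).ne' (poch_pos one_pos n).ne'

/-! ### The bound on `α` is necessary -/

/-- The image of `(1 - X) ^ K` in closed form, by Chu–Vandermonde. -/
theorem monomialOp_laguerreL_one_sub_X_pow (α : ℝ) (K : ℕ) :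
    monomialOp (laguerreL α) ((1 - X) ^ K) =
      C (K.factorial : ℝ)⁻¹ * binomPoly K fun j => poch (-α) (K - j) := by
  rw [one_sub_X_pow_eq_binomPoly, binomPoly, map_sum]
  simp only [← smul_eq_C_mul, map_smul, monomialOp_X_pow]
  ext j
  simp only [finsetSum_coeff, coeff_smul, coeff_laguerreL, smul_eq_mul, coeff_binomPoly]
  by_cases hj : j ≤ K
  · obtain ⟨N, rfl⟩ := Nat.exists_eq_add_of_le hj
    rw [add_assoc, Finset.sum_range_add, Finset.sum_eq_zero, zero_add, Nat.add_sub_cancel_left]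
    · have h := sum_choose_mul_poch_div_poch N (α + j + 1) (j + 1) (by positivity)
      rw [show (j + 1 - (α + j + 1) : ℝ) = -α by ring] at h
      have hp : ∀ k : ℕ, poch (j + 1) k = (j + k).factorial / j.factorial := fun k => by
        have := poch_add 1 j k
        rw [poch_one, poch_one, add_comm (1 : ℝ)] at this
        field_simp
        linarith
      have e : poch (-α) N = (∑ k ∈ Finset.range (N + 1),
          (-1) ^ k * (N.choose k : ℝ) * (poch (α + j + 1) k / poch (j + 1) k)) *
          ((j + N).factorial / j.factorial) := by
        rw [h, hp]; field_simp
      rw [e, Finset.sum_mul, Finset.mul_sum, Finset.mul_sum]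
      refine Finset.sum_congr rfl fun k hk => ?_
      have hk : k ≤ N := by simpa [Nat.lt_succ_iff] using hk
      rw [if_pos (Nat.le_add_right _ _), Nat.add_sub_cancel_left, hp,
        Nat.cast_choose ℝ (Nat.add_le_add_left hk j), Nat.cast_choose ℝ hk,
        Nat.cast_choose ℝ hj, Nat.add_sub_cancel_left, Nat.add_sub_add_left, pow_add]
      have : ((-1 : ℝ) ^ j) * (-1) ^ j = 1 := by rw [← mul_pow]; simp
      field_simp
      linear_combination (poch (α + j + 1) k) * this
    · intro n hn
      rw [if_neg (by simpa using hn), mul_zero]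
  · rw [Nat.choose_eq_zero_of_lt (by omega), Finset.sum_eq_zero]
    · simp
    · intro n hn
      rw [if_neg, mul_zero]
      have := Finset.mem_range.1 hn
      omega

/-- The polynomial `(1 - X) ^ K` is a counterexample when `α < K - 2`. -/
theorem lt_of_preservesRealRootednessUpTo {α : ℝ} (hα : -1 < α) (hα_int : ∀ m : ℕ, α ≠ m) {K : ℕ}
    (h : PreservesRealRootednessUpTo K (monomialOp (laguerreL α))) : (K : ℝ) - 2 < α := by
  by_contra! hle
  have hK : 2 ≤ K := by
    by_contra! hK
    have : (K : ℝ) ≤ 1 := by exact_mod_cast Nat.lt_succ_iff.1 hK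
    linarith
  obtain ⟨k, rfl⟩ := Nat.exists_eq_add_of_le hK
  have hlt : α < k := lt_of_le_of_ne (by push_cast at hle; linarith) (hα_int k)
  have hne : ∀ n, poch (-α) n ≠ 0 := fun n =>
    poch_ne_zero fun i _ h => hα_int i (by linarith)
  have h1 : OnlyRealZeros ((1 - X : ℝ[X]) ^ (2 + k)) := by
    rw [one_sub_X_pow_eq_binomPoly]
    simpa [one_add_X_pow_eq_binomPoly, mulSeq_binomPoly] using
      (onlyRealZeros_one_add_X_pow (2 + k)).mulSeq_pow (c := -1) (by norm_num)
  have h2 := h.2 _ h1 (by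
    rw [one_sub_X_pow_eq_binomPoly]; exact natDegree_binomPoly_le _ _)
  rw [monomialOp_laguerreL_one_sub_X_pow] at h2
  have h3 := h2.C_mul (c := ((2 + k).factorial : ℝ)) (by positivity)
  rw [← mul_assoc, ← C_mul, mul_inv_cancel₀ (by positivity), C_1, one_mul] at h3
  have h4 := h3.reverse_binomPoly
  rw [binomPoly_congr (b := poch (-α)) fun n hn => by rw [Nat.sub_sub_self hn]] at h4
  -- With `s = k - α > 0` the inequality reads `s (s + 1) ≤ s ^ 2` up to a positive factor.
  have h5 := h4.newton_binomPoly (hne _)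
  rw [poch_succ _ (k + 1), poch_succ] at h5
  push_cast at h5
  have := mul_pos (sq_pos_of_ne_zero (hne k)) (sub_pos.2 hlt)
  nlinarith

/-! ### The bound on `α` is sufficient -/

/-- For `α > K - 2` the polynomial `∑ binom(K, n) (-α)_{K-n} X ^ n` has only real zeros. With
`u = α - K + 1 > -1` its coefficients are proportional to `(-1) ^ n binom(K, n) (u + n) / (u + 1)_n`,
and it arises from `(1 + X) ^ K` by diagonal operators. -/
theorem onlyRealZeros_binomPoly_poch_neg {α : ℝ} (hα_int : ∀ k : ℤ, α ≠ k) {K : ℕ} (hK : 0 < K)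
    (hα : (K : ℝ) - 2 < α) : OnlyRealZeros (binomPoly K fun n => poch (-α) (K - n)) := by
  set u : ℝ := α - K + 1 with hu
  have hu1 : 0 < u + 1 := by rw [hu]; linarith
  have hun : ∀ n : ℕ, u + n ≠ 0 := fun n h => hα_int (K - 1 - n) (by
    push_cast; rw [hu] at h; linarith)
  have hu0 : u ≠ 0 := by simpa using hun 0
  have hne : ∀ n, poch (-α) n ≠ 0 := fun n =>
    poch_ne_zero fun i _ h => hα_int i (by push_cast; linarith)
  -- Both sides are multiplied by `-(n + 1 + u) / (n + u)` when `n` increases by one.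
  have hrel : ∀ n ≤ K, poch (-α) (K - n) * poch (u + 1) n =
      poch (-α) K / u * ((-1) ^ n * (n + u)) := by
    intro n
    induction n with
    | zero => intro _; simp [poch_zero]; field_simp
    | succ n ih =>
      intro hn
      have h1 := ih (by omega)
      have h2 : poch (-α) (K - n) = poch (-α) (K - (n + 1)) * -(n + u) := by
        rw [show K - n = K - (n + 1) + 1 by omega, poch_succ, Nat.cast_sub hn, hu]
        push_cast; ring
      rw [h2] at h1
      have h3 : (n : ℝ) + u ≠ 0 := by rw [add_comm]; exact hun n
      have h4 : poch (-α) (K - (n + 1)) * poch (u + 1) n = -(poch (-α) K / u * (-1) ^ n) := by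
        apply mul_right_cancel₀ h3
        linear_combination -h1
      rw [poch_succ, ← mul_assoc, h4]
      push_cast
      ring
  have hP : ∀ n, 0 < 1 / poch (u + 1) n * 1 := fun n => by
    have := poch_pos hu1 n
    positivity
  have h1 := onlyRealZeros_mulSeq_one_div_poch hu1 (onlyRealZeros_one_add_X_pow K)
  rw [one_add_X_pow_eq_binomPoly, mulSeq_binomPoly] at h1
  have h2 := onlyRealZeros_mulSeq_add_of_neg u h1
    (fun x hx => by
      by_contra! hx0
      exact (eval_binomPoly_pos hP hx0).ne' hx)
    (by rw [natDegree_binomPoly (hP K).ne']; exact hK)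
  have h3 := (h2.mulSeq_pow (c := -1) (by norm_num)).C_mul (div_ne_zero (hne K) hu0)
  rw [← mulSeq_const, mulSeq_binomPoly, mulSeq_binomPoly, mulSeq_binomPoly] at h3
  convert h3 using 1
  refine binomPoly_congr fun n hn => ?_
  have := (poch_pos hu1 n).ne'
  have e := hrel n hn
  rw [mul_one, mul_one_div, ← mul_div_assoc, ← mul_div_assoc, ← e]
  field_simp

/-- A Pfaff transformation, `₂F₁(-K, 1 + α; 1; -x)` being `(1 + x) ^ K` times
`₂F₁(-K, -α; 1; x / (1 + x))`. -/
theorem binomPoly_poch_div_poch_one (α : ℝ) (K : ℕ) :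
    binomPoly K (fun n => poch (1 + α) n / poch 1 n) = ∑ k ∈ Finset.range (K + 1),
      C (K.choose k * ((-1) ^ k * (poch (-α) k / poch 1 k))) * (X ^ k * (1 + X) ^ (K - k)) := by
  ext n
  have hsum := sum_choose_mul_poch_div_poch n (-α) 1 one_pos
  rw [sub_neg_eq_add] at hsum
  simp only [coeff_binomPoly, finsetSum_coeff, coeff_C_mul, coeff_X_pow_mul',
    coeff_one_add_X_pow]
  rw [← hsum]
  by_cases hn : n ≤ K
  · rw [Finset.mul_sum, Finset.sum_subset (Finset.range_subset_range.2 (Nat.succ_le_succ hn))]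
    · refine Finset.sum_congr rfl fun k hk => ?_
      split_ifs with hkn
      · have := congrArg (Nat.cast (R := ℝ)) (Nat.choose_mul (n := K) hkn)
        push_cast at this
        linear_combination ((-1) ^ k * (poch (-α) k / poch 1 k)) * this
      · rw [Nat.choose_eq_zero_of_lt (by omega : n < k)]; simp
    · intro k _ hk
      rw [Nat.choose_eq_zero_of_lt (by simpa using hk : n < k)]; simp
  · rw [Nat.choose_eq_zero_of_lt (by omega : K < n), Nat.cast_zero, zero_mul, eq_comm]
    refine Finset.sum_eq_zero fun k hk => ?_
    have := Finset.mem_range.1 hk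
    rw [if_pos (by omega), Nat.choose_eq_zero_of_lt (by omega : K - k < n - k)]
    simp

theorem onlyRealZeros_binomPoly_poch_div_poch_one {α : ℝ} (hα_int : ∀ k : ℤ, α ≠ k) {K : ℕ}
    (hK : 0 < K) (hα : (K : ℝ) - 2 < α) :
    OnlyRealZeros (binomPoly K fun n => poch (1 + α) n / poch 1 n) := by
  have h1 := (onlyRealZeros_binomPoly_poch_neg hα_int hK hα).reverse_binomPoly
  rw [binomPoly_congr (b := poch (-α)) fun n hn => by rw [Nat.sub_sub_self hn]] at h1
  have h2 := (onlyRealZeros_mulSeq_one_div_poch one_pos h1).mulSeq_pow (c := -1) (by norm_num)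
  rw [mulSeq_binomPoly, mulSeq_binomPoly] at h2
  refine onlyRealZeros_of_upper fun z hz h0 => ?_
  have hz1 : 1 + z ≠ 0 := fun h => by
    have := congrArg Complex.im h
    simp at this
    linarith
  have him : (z / (1 + z)).im ≠ 0 := by
    have : z / (1 + z) = 1 - (1 + z)⁻¹ := by field_simp; ring
    rw [this, Complex.sub_im, Complex.inv_im]
    have := Complex.normSq_pos.2 hz1
    simp
    exact ⟨hz.ne', hz1⟩
  refine him (h2 _ ?_)
  rw [aeval_binomPoly]
  rw [binomPoly_poch_div_poch_one, map_sum] at h0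
  refine (mul_eq_zero.1 (?_ : (1 + z) ^ K * _ = 0)).resolve_left (pow_ne_zero K hz1)
  rw [← h0, Finset.mul_sum]
  refine Finset.sum_congr rfl fun k hk => ?_
  have hk : k ≤ K := by simpa [Nat.lt_succ_iff] using hk
  obtain ⟨l, rfl⟩ := Nat.exists_eq_add_of_le hk
  have := (poch_pos one_pos k).ne'
  simp only [map_mul, aeval_C, map_pow, aeval_X, map_add, map_one, Nat.add_sub_cancel_left,
    Complex.coe_algebraMap]
  push_cast
  rw [div_pow, pow_add]
  field_simp

/-! ### The four families -/

theorem corollary1p8 :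
    (∀ α : ℝ, -1 < α → (∀ m : ℕ, α ≠ (m : ℝ)) → ∀ K : ℕ, 1 ≤ K →
      (PreservesRealRootednessUpTo K (monomialOp (laguerreL α)) ↔ (K : ℝ) - 2 < α)) ∧
    (∀ m : ℕ, PreservesRealRootedness (monomialOp (laguerreL (m : ℝ)))) ∧
    (∀ α : ℝ, -1 < α → PreservesRealRootedness (monomialOp (laguerreUnit α))) ∧
    (∀ α : ℝ, -1 < α → PreservesRealRootedness (monomialOp (laguerreBrenke α))) := by
  refine ⟨fun α hα hnat K hK => ⟨lt_of_preservesRealRootednessUpTo hα hnat, fun hKα =>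
    ⟨degree_monomialOp_laguerreL hα, fun p hp hdeg => ?_⟩⟩, fun m K _ =>
    ⟨degree_monomialOp_laguerreL ?_, fun p hp _ => ?_⟩, fun α hα K _ =>
    ⟨degree_monomialOp_laguerreUnit hα, fun p hp _ =>
      onlyRealZeros_monomialOp_laguerreUnit hα hp⟩, fun α hα K _ => ⟨fun p => ?_, fun p hp _ => ?_⟩⟩
  · have hα_int : ∀ k : ℤ, α ≠ k := by
      intro k hk
      have : (-1 : ℤ) < k := by exact_mod_cast hk ▸ hα
      lift k to ℕ using by omega
      exact hnat k (by simpa using hk)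
    have hpos : ∀ n, 0 < poch (1 + α) n / poch 1 n := fun n =>
      div_pos (poch_pos (by linarith) n) (poch_pos one_pos n)
    rw [monomialOp_laguerreL hα]
    refine onlyRealZeros_monomialOp_laguerreUnit hα (onlyRealZeros_mulSeq_of_binomPoly (K := K)
      (by simp [poch_zero]) (hpos K).ne' (onlyRealZeros_binomPoly_poch_div_poch_one hα_int hK hKα)
      (fun x hx => ?_) hp hdeg)
    by_contra! hx0
    exact (eval_binomPoly_pos hpos hx0).ne' hx
  · linarith [(Nat.cast_nonneg m : (0 : ℝ) ≤ m)]
  · have hm : (-1 : ℝ) < m := by linarith [(Nat.cast_nonneg m : (0 : ℝ) ≤ m)]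
    rw [monomialOp_laguerreL hm]
    exact onlyRealZeros_monomialOp_laguerreUnit hm (onlyRealZeros_mulSeq_poch_div one_pos hp m)
  · rw [monomialOp_laguerreBrenke, degree_monomialOp_laguerreUnit hα, degree_mulSeq]
    exact fun n => one_div_ne_zero (poch_pos one_pos n).ne'
  · rw [monomialOp_laguerreBrenke]
    exact onlyRealZeros_monomialOp_laguerreUnit hα (onlyRealZeros_mulSeq_one_div_poch one_pos hp)
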